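/- Let $A$ be an AW*-algebra, that is, a unital complex C*-algebra in which the right annihilator of every subset is of the form $pA$ for a projection $p$. For projections, $e\le f$ means $e=ef$, $e\sim f$ means $e=vv^*$, $f=v^*v$ for some $v\in A$, the sum of an orthogonal family of projections is its supremum in the lattice of projections, and $C(e)$ denotes the central cover of $e$ (the least central projection above $e$). A nonzero projection $e$ is properly infinite if $e=e_1+e_2$ for some projections $e_1\sim e_2\sim e$. For such $e$ let $d(e)$ be the least cardinal strictly greater than $\operatorname{card} I$ for every orthogonal family $(e_i)_{i\in I}$ of projections with $e=\sum_i e_i$ and all $e_i\sim e$, and let $\bar d(e)=\sup\{d(ze) : 0<z\le C(e),\ z\text{ a central projection}\}$; put $d(0)=0$. A properly infinite projection $e$ is equidimensional if $d(ze)=d(e)$ for every central projection $0<z\le C(e)$, and $0$ is equidimensional by convention; $e$ is $\alpha$-equidimensional if it is equidimensional and $d(e)=\alpha$. **Theorem.** Let $e$ be a properly infinite projection in an AW*-algebra $A$. (a) For each infinite cardinal $\alpha\le\bar d(e)$ for which there is a central projection $z\le C(e)$ with $ze$ $\alpha$-equidimensional, there is a largest such $z$, denoted $z_\alpha$; for the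 other infinite cardinals $\alpha\le\bar d(e)$ put $z_\alpha=0$. The projections $z_\alpha$ are orthogonal for distinct $\alpha$. (b) Letting $\alpha$ range over the infinite cardinals $\alpha\le\bar d(e)$, we have $C(e)=\sum_\alpha z_\alpha$. Consequently $e=\sum_\alpha z_\alpha e$ is a sum of (orthogonal) equidimensional projections. -/

import Mathlib

open scoped Cardinal

universe u v

/-- A (unital, complex) C*-algebra is an AW*-algebra when the right annihilator
`{x | s x = 0 for all s ∈ S}` of every subset `S` is the right ideal `p A` generated by a
single projection `p`. -/
class IsAWStarAlgebra (A : Type u) [CStarAlgebra A] : Prop where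
  exists_projection : ∀ S : Set A, ∃ p : A, IsStarProjection p ∧
    {x : A | ∀ s ∈ S, s * x = 0} = Set.range (fun y : A => p * y)

namespace AWStar

variable {A : Type u} [CStarAlgebra A]

/-- The order on projections: `e ≤ f` if and only if `e = e f`. -/
def ProjLE (e f : A) : Prop := e * f = e

/-- Central projections. -/
def IsCentralProj (z : A) : Prop := IsStarProjection z ∧ z ∈ Set.center A

/-- `p` is the supremum of `S` in the partially ordered set of projections of `A`. -/
def IsProjSup (S : Set A) (p : A) : Prop :=
  IsStarProjection p ∧ (∀ s ∈ S, ProjLE s p) ∧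
    ∀ q : A, IsStarProjection q → (∀ s ∈ S, ProjLE s q) → ProjLE p q

/-- `e = ∑ f i`: the `f i` form an orthogonal family of projections with supremum `e`. -/
def IsProjSum {ι : Type v} (f : ι → A) (e : A) : Prop :=
  (∀ i, IsStarProjection (f i)) ∧ (∀ i j, i ≠ j → f i * f j = 0) ∧ IsProjSup (Set.range f) e

/-- Equivalence of projections: `e = v v*` and `f = v* v` for some `v` in `A`. -/
def Equivalent (e f : A) : Prop := ∃ v : A, e = v * star v ∧ f = star v * v

theorem exists_centralCover [IsAWStarAlgebra A] (e : A) :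
    ∃ c : A, IsCentralProj c ∧ ProjLE e c ∧ ∀ z : A, IsCentralProj z → ProjLE e z → ProjLE c z := by
  obtain ⟨p, hp, hS⟩ := IsAWStarAlgebra.exists_projection (Set.range fun a : A => e * a)
  have hpp : p * p = p := hp.isIdempotentElem
  have hps : star p = p := hp.isSelfAdjoint
  have mem : ∀ x : A, (∀ a, e * a * x = 0) ↔ p * x = x := by
    intro x
    have h : x ∈ {x : A | ∀ s ∈ Set.range (fun a : A => e * a), s * x = 0} ↔
        x ∈ Set.range (fun y : A => p * y) := by rw [hS]
    simp only [Set.mem_ofPred_eq, Set.mem_range, forall_exists_index, forall_apply_eq_imp_iff] at h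
    rw [h]
    constructor
    · rintro ⟨y, rfl⟩
      rw [← mul_assoc, hpp]
    · intro hx
      exact ⟨x, hx⟩
  have hp0 : ∀ a, e * a * p = 0 := (mem p).2 hpp
  have h1 : ∀ a, p * (a * p) = a * p := fun a => (mem (a * p)).1 fun b => by
    rw [← mul_assoc, mul_assoc e b a]
    exact hp0 (b * a)
  have hc : ∀ a, p * a = a * p := by
    intro a
    have h2 := congrArg star (h1 (star a))
    simp only [star_mul, star_star, hps] at h2
    rw [← h2, mul_assoc, h1 a]
  refine ⟨1 - p, ⟨hp.one_sub, ?_⟩, ?_, ?_⟩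
  · rw [Semigroup.mem_center_iff]
    intro a
    rw [mul_sub, sub_mul, hc a, mul_one, one_mul]
  · have := hp0 1
    rw [mul_one] at this
    rw [ProjLE, mul_sub, mul_one, this, sub_zero]
  · rintro z ⟨-, hz⟩ hez
    rw [Semigroup.mem_center_iff] at hz
    have h3 : p * (1 - z) = 1 - z := (mem (1 - z)).1 fun a => by
      have h4 : e * a * z = e * a := by
        rw [mul_assoc, hz a, ← mul_assoc, show e * z = e from hez]
      rw [mul_sub, mul_one, h4, sub_self]
    rw [ProjLE, sub_mul, one_mul]
    rw [mul_sub, mul_one] at h3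
    have h5 : p * z = p - (1 - z) := by rw [← h3]; abel
    rw [h5]; abel

/-- The central cover of `e`: the least central projection above `e`. -/
noncomputable def centralCover [IsAWStarAlgebra A] (e : A) : A := (exists_centralCover e).choose

theorem centralCover_spec [IsAWStarAlgebra A] (e : A) :
    IsCentralProj (centralCover e) ∧ ProjLE e (centralCover e) ∧
      ∀ z : A, IsCentralProj z → ProjLE e z → ProjLE (centralCover e) z :=
  (exists_centralCover e).choose_spec

/-- A nonzero projection `e` is properly infinite when `e = e₁ + e₂` for some projections
`e₁ ∼ e₂ ∼ e` (which are then automatically orthogonal). -/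
def IsProperlyInfinite (e : A) : Prop :=
  IsStarProjection e ∧ e ≠ 0 ∧ ∃ e₁ e₂ : A, IsStarProjection e₁ ∧ IsStarProjection e₂ ∧
    Equivalent e₁ e₂ ∧ Equivalent e₂ e ∧ e = e₁ + e₂

/-- `f` belongs to `Γ(e)`: it is an orthogonal family of projections equivalent to `e`
with `e = ∑ f i`. -/
def IsGamma {I : Type u} (e : A) (f : I → A) : Prop :=
  IsProjSum f e ∧ ∀ i, Equivalent (f i) e

open Classical in
/-- `d(e)`: the least cardinal strictly greater than the cardinality of every family in `Γ(e)`,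
and `d(0) = 0`. (The members of a family in `Γ(e)` with `e ≠ 0` are distinct elements of `A`, so
index types in the universe of `A` suffice.) -/
noncomputable def dim (e : A) : Cardinal.{u} :=
  if e = 0 then 0
  else sInf {κ : Cardinal.{u} | ∀ (I : Type u) (f : I → A), IsGamma e f → #I < κ}

/-- The supremum of `d(z e)` over the nonzero central projections `z` below the central cover of
`e` (it is `0` for `e = 0`). -/
noncomputable def dimBar [IsAWStarAlgebra A] (e : A) : Cardinal.{u} :=
  ⨆ z : {z : A // IsCentralProj z ∧ z ≠ 0 ∧ ProjLE z (centralCover e)}, dim (z.1 * e)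

/-- `e` is equidimensional: it is properly infinite and `d(z e) = d(e)` for every nonzero central
projection `z` below the central cover of `e`; by convention `0` is equidimensional too. -/
def IsEquidimensional [IsAWStarAlgebra A] (e : A) : Prop :=
  e = 0 ∨ (IsProperlyInfinite e ∧
    ∀ z : A, IsCentralProj z → z ≠ 0 → ProjLE z (centralCover e) → dim (z * e) = dim e)

/-- `e` is `α`-equidimensional: it is equidimensional with `d(e) = α`. In particular `0` is
`0`-equidimensional and not `α`-equidimensional for any other `α`. -/
def IsEquidimensionalOf [IsAWStarAlgebra A] (α : Cardinal.{u}) (e : A) : Prop :=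
  IsEquidimensional e ∧ dim e = α

end AWStar

/-! Everything follows from one fact: for each cardinal `c ≠ 0`, among the central `z ≤ C(e)` the
condition `c < d(ze)` is, for `z ≠ 0`, equivalent to `z ≤ y c` for a fixed central projection `y c`.
Given this, for infinite `α` the projection `ze` is `α`-equidimensional exactly when `z ≠ 0`, `z ≤ y
c` for all infinite `c < α`, and `z * y α = 0` (`IsProperlyInfinite.isEquidimensionalOf_iff`). The
last two conditions survive suprema, which gives the largest `z_α`. For `α < β`, `z_β ≤ y α` while
`z_α * y α = 0`, so the two are orthogonal. If `p = C(e) - sup z_α` were nonzero, let `c` be the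
least infinite cardinal with `p ≰ y c`; then `p * (1 - y c)` would be a nonzero `c`-equidimensional
piece outside every `z_α`.

The existence of `y c` has two ingredients. By Schröder–Bernstein (`Equivalent.of_between`) the
remainder of a family of copies of `e` can be absorbed into one member, so `Γ(e)` is closed under
shrinking to a nonempty index set, and `c < d(e)` just says that `Γ(e)` has a family of size `c`. By
gluing (`IsProperlyInfinite.exists_glue`) such families over orthogonal central projections combine
into one over their supremum, so a maximal orthogonal set of admissible `z` has `y c` as its
supremum. An AW*-algebra provides suprema of projections but no strong sums of partial isometries;
proper infiniteness makes room to encode a partial isometry as a projection. -/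

namespace AWStar

/-! ### Projections and central projections -/

section Order

variable {A : Type u} [CStarAlgebra A] {e f g p z : A}

theorem ProjLE.mul_eq_right (he : IsStarProjection e) (hf : IsStarProjection f)
    (h : ProjLE e f) : f * e = e := by
  have h1 := congrArg star (show e * f = e from h)
  rwa [star_mul, he.isSelfAdjoint.star_eq, hf.isSelfAdjoint.star_eq] at h1

theorem ProjLE.trans (h : ProjLE e f) (h' : ProjLE f g) : ProjLE e g := by
  unfold ProjLE at *
  rw [← h, mul_assoc, h']

theorem ProjLE.antisymm (he : IsStarProjection e) (hf : IsStarProjection f)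
    (h : ProjLE e f) (h' : ProjLE f e) : e = f := by
  rw [← h'.mul_eq_right hf he]
  exact h.symm

theorem projLE_refl (he : IsStarProjection e) : ProjLE e e := he.isIdempotentElem

theorem IsCentralProj.comm (hz : IsCentralProj z) (a : A) : a * z = z * a :=
  Semigroup.mem_center_iff.1 hz.2 a

theorem isCentralProj_iff : IsCentralProj z ↔ IsStarProjection z ∧ ∀ a, a * z = z * a :=
  and_congr_right fun _ => Semigroup.mem_center_iff

theorem isStarProjection_mul_of_comm (he : IsStarProjection e) (hf : IsStarProjection f)
    (h : e * f = f * e) : IsStarProjection (e * f) := by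
  refine ⟨?_, ?_⟩
  · change e * f * (e * f) = e * f
    rw [mul_assoc, ← mul_assoc f, ← h, mul_assoc e f f, show f * f = f from hf.isIdempotentElem,
      ← mul_assoc, show e * e = e from he.isIdempotentElem]
  · rw [IsSelfAdjoint, star_mul, he.isSelfAdjoint.star_eq, hf.isSelfAdjoint.star_eq, h]

theorem IsCentralProj.mul_isStarProjection (hz : IsCentralProj z) (he : IsStarProjection e) :
    IsStarProjection (z * e) :=
  isStarProjection_mul_of_comm hz.1 he (hz.comm e).symm

theorem IsCentralProj.mul (hz : IsCentralProj z) (hp : IsCentralProj p) :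
    IsCentralProj (z * p) := by
  refine isCentralProj_iff.2 ⟨hz.mul_isStarProjection hp.1, fun a => ?_⟩
  rw [← mul_assoc, hz.comm, mul_assoc, hp.comm, mul_assoc]

theorem IsCentralProj.mul_mul_mul (hz : IsCentralProj z) (a b : A) :
    z * a * (z * b) = z * (a * b) := by
  rw [mul_assoc, ← mul_assoc a, hz.comm, mul_assoc, ← mul_assoc,
    show z * z = z from hz.1.isIdempotentElem]

theorem IsCentralProj.one_sub (hz : IsCentralProj z) : IsCentralProj (1 - z) := by
  refine isCentralProj_iff.2 ⟨hz.1.one_sub, fun a => ?_⟩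
  rw [mul_sub, sub_mul, hz.comm, mul_one, one_mul]

theorem IsCentralProj.mul_left_projLE (hz : IsCentralProj z) (a : A) : ProjLE (z * a) z := by
  rw [ProjLE, hz.comm, ← mul_assoc, show z * z = z from hz.1.isIdempotentElem]

theorem IsCentralProj.mul_projLE (hz : IsCentralProj z) (h : ProjLE e f) :
    ProjLE (z * e) (z * f) := by
  unfold ProjLE at *
  rw [mul_assoc, ← mul_assoc e, hz.comm e, mul_assoc z e, h, ← mul_assoc,
    show z * z = z from hz.1.isIdempotentElem]

theorem projLE_one_sub_iff : ProjLE e (1 - f) ↔ e * f = 0 := by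
  rw [ProjLE, mul_sub, mul_one, sub_eq_self]

theorem isStarProjection_sub (he : IsStarProjection e) (hf : IsStarProjection f)
    (h : ProjLE e f) : IsStarProjection (f - e) := by
  refine ⟨?_, ?_⟩
  · change (f - e) * (f - e) = f - e
    rw [mul_sub, sub_mul, sub_mul, show f * f = f from hf.isIdempotentElem,
      show e * e = e from he.isIdempotentElem, h.mul_eq_right he hf, show e * f = e from h]
    abel
  · rw [IsSelfAdjoint, star_sub, he.isSelfAdjoint.star_eq, hf.isSelfAdjoint.star_eq]

theorem isStarProjection_add (he : IsStarProjection e) (hf : IsStarProjection f)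
    (h : e * f = 0) : IsStarProjection (e + f) := by
  have h' : f * e = 0 := by
    have h1 := congrArg star h
    rwa [star_mul, he.isSelfAdjoint.star_eq, hf.isSelfAdjoint.star_eq, star_zero] at h1
  refine ⟨?_, ?_⟩
  · change (e + f) * (e + f) = e + f
    rw [mul_add, add_mul, add_mul, show f * f = f from hf.isIdempotentElem,
      show e * e = e from he.isIdempotentElem, h, h']
    abel
  · rw [IsSelfAdjoint, star_add, he.isSelfAdjoint.star_eq, hf.isSelfAdjoint.star_eq]

end Order

/-! ### Suprema in the projection lattice -/

section Sup

variable {A : Type u} [CStarAlgebra A] {S : Set A} {p q : A}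

theorem exists_isProjSup [IsAWStarAlgebra A] (S : Set A) :
    ∃ p : A, IsProjSup S p := by
  obtain ⟨q, hq, h⟩ := IsAWStarAlgebra.exists_projection S
  have mem : ∀ x : A, (∀ s ∈ S, s * x = 0) ↔ q * x = x := by
    intro x
    have h1 : x ∈ {x : A | ∀ s ∈ S, s * x = 0} ↔ x ∈ Set.range (fun y : A => q * y) := by rw [h]
    refine h1.trans ⟨?_, fun hx => ⟨x, hx⟩⟩
    rintro ⟨y, rfl⟩
    change q * (q * y) = q * y
    rw [← mul_assoc, show q * q = q from hq.isIdempotentElem]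
  refine ⟨1 - q, hq.one_sub, fun s hs => ?_, fun r hr hSr => ?_⟩
  · exact projLE_one_sub_iff.2 ((mem q).2 hq.isIdempotentElem s hs)
  · have h2 := (mem (1 - r)).1 fun s hs => by
      rw [mul_sub, mul_one, show s * r = s from hSr s hs, sub_self]
    have h3 : (1 - q) * (1 - r) = 0 := by rw [sub_mul, one_mul, h2, sub_self]
    rwa [mul_sub, mul_one, sub_eq_zero, eq_comm] at h3

/-- The right annihilator of `S` is `qA`, so every `s ∈ S` lies below `1 - q`, hence so does `p`.
This substitutes for convergence of sums: an identity after left multiplication by `p` may be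
checked on the members of `S`. -/
theorem IsProjSup.mul_eq_zero [IsAWStarAlgebra A] (h : IsProjSup S p) {x : A}
    (hx : ∀ s ∈ S, s * x = 0) : p * x = 0 := by
  obtain ⟨q, hq, hS⟩ := IsAWStarAlgebra.exists_projection S
  have hqS : q ∈ {x : A | ∀ s ∈ S, s * x = 0} := by
    rw [hS]; exact ⟨q, hq.isIdempotentElem⟩
  have hxS : x ∈ Set.range (fun y : A => q * y) := by
    rw [← hS]; exact hx
  obtain ⟨y, rfl⟩ := hxS
  have hpq : p * q = 0 :=
    projLE_one_sub_iff.1 (h.2.2 _ hq.one_sub fun s hs => projLE_one_sub_iff.2 (hqS s hs))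
  change p * (q * y) = 0
  rw [← mul_assoc, hpq, zero_mul]

theorem IsProjSup.mul_eq_mul [IsAWStarAlgebra A] (h : IsProjSup S p) {x y : A}
    (hx : ∀ s ∈ S, s * x = s * y) : p * x = p * y := by
  rw [← sub_eq_zero, ← mul_sub]
  exact h.mul_eq_zero fun s hs => by rw [mul_sub, hx s hs, sub_self]

/-- Each `s` kills `a * (1 - p)` from the left, since `s` commutes with `a`; hence `p * a = p * a *
p` for every `a`, and taking adjoints gives commutation. -/
theorem IsProjSup.isCentralProj [IsAWStarAlgebra A] (h : IsProjSup S p)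
    (hS : ∀ s ∈ S, IsCentralProj s) : IsCentralProj p := by
  have h1 : ∀ a, p * (a * (1 - p)) = 0 := fun a => h.mul_eq_zero fun s hs => by
    rw [← mul_assoc, ← (hS s hs).comm, mul_assoc, mul_sub, mul_one,
      show s * p = s from h.2.1 s hs, sub_self, mul_zero]
  have h2 : ∀ a, p * a = p * a * p := fun a => by
    have := h1 a
    rwa [mul_sub, mul_one, mul_sub, sub_eq_zero, ← mul_assoc] at this
  refine isCentralProj_iff.2 ⟨h.1, fun a => ?_⟩
  have h3 := congrArg star (h2 (star a))
  simp only [star_mul, star_star, h.1.isSelfAdjoint.star_eq] at h3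
  rw [h3, ← mul_assoc, ← h2]

/-- A central projection cuts the supremum of a family supported on orthogonal central
projections down to the corresponding member. -/
theorem IsProjSup.central_mul_eq [IsAWStarAlgebra A] {ι : Type v} {z g : ι → A} {p : A}
    (h : IsProjSup (Set.range g) p) (hz : ∀ i, IsCentralProj (z i))
    (ho : ∀ i j, i ≠ j → z i * z j = 0) (hg : ∀ i, IsStarProjection (g i))
    (hgz : ∀ i, ProjLE (g i) (z i)) (i : ι) : z i * p = g i := by
  have h1 : p * (z i * (1 - g i)) = 0 := by
    refine h.mul_eq_zero ?_
    rintro _ ⟨j, rfl⟩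
    by_cases hij : j = i
    · subst hij
      rw [← mul_assoc, show g j * z j = g j from hgz j, mul_sub, mul_one,
        show g j * g j = g j from (hg j).isIdempotentElem, sub_self]
    · rw [← show g j * z j = g j from hgz j, mul_assoc, ← mul_assoc (z j), ho j i hij, zero_mul,
        mul_zero]
  have h2 : g i * p = g i := h.2.1 _ ⟨i, rfl⟩
  rw [mul_sub, mul_one, (hgz i).mul_eq_right (hg i) (hz i).1, mul_sub, sub_eq_zero,
    (show ProjLE (g i) p from h2).mul_eq_right (hg i) h.1, (hz i).comm] at h1
  exact h1

end Sup

/-! ### Equivalence of projections and Schröder–Bernstein -/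

section Equivalent

variable {A : Type u} [CStarAlgebra A] {e f g p v w z : A}

theorem mul_eq_self_of_star_mul_self (he : IsStarProjection e) (h : star v * v = e) :
    v * e = v := by
  rw [← sub_eq_zero, ← CStarRing.star_mul_self_eq_zero_iff]
  have h1 : e * e = e := he.isIdempotentElem
  have h2 : star v * (v * e - v) = 0 := by rw [mul_sub, ← mul_assoc, h, h1, sub_self]
  rw [star_sub, star_mul, sub_mul, mul_assoc, h2, mul_zero, sub_self]

theorem isStarProjection_mul_star_self (he : IsStarProjection e) (h : star v * v = e) :
    IsStarProjection (v * star v) := by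
  refine ⟨?_, .mul_star_self v⟩
  change v * star v * (v * star v) = v * star v
  rw [mul_assoc, ← mul_assoc (star v), h, ← mul_assoc, mul_eq_self_of_star_mul_self he h]

theorem Equivalent.ne_zero (h : Equivalent f e) (he : e ≠ 0) : f ≠ 0 := by
  obtain ⟨v, hf, hv⟩ := h
  rintro rfl
  rw [eq_comm, CStarRing.mul_star_self_eq_zero_iff] at hf
  rw [hf, mul_zero] at hv
  exact he hv

theorem Equivalent.trans (hf : IsStarProjection f)
    (h : Equivalent e f) (h' : Equivalent f g) : Equivalent e g := by
  obtain ⟨v, hv, hv'⟩ := h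
  obtain ⟨w, hw, hw'⟩ := h'
  refine ⟨v * w, ?_, ?_⟩
  · rw [star_mul, mul_assoc, ← mul_assoc w, ← hw, ← mul_assoc,
      mul_eq_self_of_star_mul_self hf hv'.symm, hv]
  · have h1 : star w * f = star w := by
      have := mul_eq_self_of_star_mul_self (v := star w) hf (by rw [star_star, hw])
      exact this
    rw [star_mul, mul_assoc, ← mul_assoc (star v), ← hv', ← mul_assoc, h1, hw']

theorem Equivalent.central_mul (hz : IsCentralProj z) (h : Equivalent e f) :
    Equivalent (z * e) (z * f) := by
  obtain ⟨v, rfl, rfl⟩ := h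
  have h2 : star (z * v) = z * star v := by
    rw [star_mul, hz.1.isSelfAdjoint.star_eq, hz.comm]
  exact ⟨z * v, by rw [h2, hz.mul_mul_mul], by rw [h2, hz.mul_mul_mul]⟩

/-- The Schröder–Bernstein theorem for projections, in the nested form. -/
theorem Equivalent.of_between [IsAWStarAlgebra A] (he : IsStarProjection e)
    (hg : IsStarProjection g) (hp : IsStarProjection p) (hpg : ProjLE p g) (hge : ProjLE g e)
    (h : Equivalent p e) : Equivalent g e := by
  obtain ⟨v, hv, hv'⟩ := h
  have hve : v * e = v := mul_eq_self_of_star_mul_self he hv'.symm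
  have hev : e * star v = star v := by
    have := congrArg star hve
    rwa [star_mul, he.isSelfAdjoint.star_eq] at this
  have hvp : p * v = v := by rw [hv, mul_assoc, ← hv', hve]
  have hgv : g * v = v := by
    rw [← hvp, ← mul_assoc, hpg.mul_eq_right hp hg]
  have heg : e * g = g := hge.mul_eq_right hg he
  have hsub : IsStarProjection (e - g) := isStarProjection_sub hg he hge
  have hev2 : e * v = v := by rw [← hgv, ← mul_assoc, heg]
  have hov : (e - g) * v = 0 := by rw [sub_mul, hev2, hgv, sub_self]
  have hvo : star v * (e - g) = 0 := by
    have := congrArg star hov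
    rwa [star_mul, hsub.isSelfAdjoint.star_eq, star_zero] at this
  have hsve : star v * e = star v := by
    have := congrArg star hev2
    rwa [star_mul, he.isSelfAdjoint.star_eq] at this
  have hsvg : star v * g = star v := by
    have := congrArg star hgv
    rwa [star_mul, hg.isSelfAdjoint.star_eq] at this
  -- Tarski's fixed point argument: `φ` is monotone on the projections below `e`, and a fixed point
  -- `x` satisfies `e - x = g - v * x * star v`.
  let φ : A → A := fun x => (e - g) + v * x * star v
  have conj_mul : ∀ x y, ProjLE x e → v * x * star v * (v * y * star v) = v * (x * y) * star v := by
    intro x y hx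
    calc v * x * star v * (v * y * star v) = v * x * (star v * v) * y * star v := by
          simp only [mul_assoc]
      _ = v * (x * y) * star v := by
          rw [← hv', mul_assoc v x e, show x * e = x from hx, mul_assoc v x y]
  have conj_proj : ∀ x, IsStarProjection x → ProjLE x e → IsStarProjection (v * x * star v) := by
    refine fun x hx hxe => ⟨?_, ?_⟩
    · change _ * _ = _
      rw [conj_mul x x hxe, show x * x = x from hx.isIdempotentElem]
    · rw [IsSelfAdjoint, star_mul, star_mul, star_star, hx.isSelfAdjoint.star_eq, mul_assoc]
  have cross1 : ∀ x, (e - g) * (v * x * star v) = 0 := fun x => by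
    rw [← mul_assoc, ← mul_assoc, hov, zero_mul, zero_mul]
  have cross2 : ∀ x, v * x * star v * (e - g) = 0 := fun x => by
    rw [mul_assoc, hvo, mul_zero]
  have φ_proj : ∀ x, IsStarProjection x → ProjLE x e → IsStarProjection (φ x) :=
    fun x hx hxe => isStarProjection_add hsub (conj_proj x hx hxe) (cross1 x)
  have φ_le : ∀ x, ProjLE (φ x) e := fun x => by
    change ((e - g) + v * x * star v) * e = (e - g) + v * x * star v
    rw [add_mul, sub_mul, show e * e = e from he.isIdempotentElem, show g * e = g from hge,
      mul_assoc (v * x), hsve]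
  have φ_mono : ∀ x y, ProjLE x e → ProjLE x y → ProjLE (φ x) (φ y) := fun x y hxe hxy => by
    change ((e - g) + v * x * star v) * ((e - g) + v * y * star v) = (e - g) + v * x * star v
    rw [mul_add, add_mul, add_mul, cross1, cross2, conj_mul x y hxe, show x * y = x from hxy,
      show (e - g) * (e - g) = e - g from hsub.isIdempotentElem]
    abel
  -- The supremum of all `y ≤ φ y` is a fixed point.
  obtain ⟨x, hx⟩ := exists_isProjSup {y : A | IsStarProjection y ∧ ProjLE y e ∧ ProjLE y (φ y)}
  have hxe : ProjLE x e := hx.2.2 e he fun s hs => hs.2.1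
  have hx1 : ProjLE x (φ x) := hx.2.2 _ (φ_proj x hx.1 hxe) fun s hs =>
    hs.2.2.trans (φ_mono s x hs.2.1 (hx.2.1 s hs))
  have hx2 : ProjLE (φ x) x :=
    hx.2.1 _ ⟨φ_proj x hx.1 hxe, φ_le x, φ_mono _ _ hxe hx1⟩
  have hfix : x = (e - g) + v * x * star v := hx1.antisymm hx.1 (φ_proj x hx.1 hxe) hx2
  have hxx : x * x = x := hx.1.isIdempotentElem
  have hex : e * x = x := hxe.mul_eq_right hx.1 he
  have hd : e - x = g - v * x * star v := by
    rw [sub_eq_sub_iff_add_eq_add]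
    nth_rw 2 [hfix]
    abel
  have hdp : IsStarProjection (e - x) := isStarProjection_sub hx.1 he hxe
  have hdd : (e - x) * (e - x) = e - x := hdp.isIdempotentElem
  have h1 : x * star v * (e - x) = 0 := by
    rw [hd, mul_sub, mul_assoc, hsvg]
    have : x * star v * (v * x * star v) = x * (star v * v) * x * star v := by
      simp only [mul_assoc]
    rw [this, ← hv', show x * e = x from hxe, hxx, sub_self]
  have h2 : (e - x) * (v * x) = 0 := by
    have := congrArg star h1
    simpa only [star_mul, star_zero, star_star, hdp.isSelfAdjoint.star_eq,
      hx.1.isSelfAdjoint.star_eq] using this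
  have h3 : x * (e - x) = 0 := by rw [mul_sub, hxx, show x * e = x from hxe, sub_self]
  have h4 : (e - x) * x = 0 := by rw [sub_mul, hxx, hex, sub_self]
  -- Use `v` on `x` and the identity on `e - x`; the ranges `v * x * star v` and `e - x` add up to
  -- `g`.
  refine ⟨v * x + (e - x), ?_, ?_⟩
  · rw [star_add, star_mul, hdp.isSelfAdjoint.star_eq, hx.1.isSelfAdjoint.star_eq, mul_add, add_mul,
      add_mul, hdd, ← mul_assoc (e - x), h4, mul_assoc v x (e - x), h3, ← mul_assoc (v * x) x,
      mul_assoc v x x, hxx, hd]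
    simp
  · rw [star_add, star_mul, hdp.isSelfAdjoint.star_eq, hx.1.isSelfAdjoint.star_eq, mul_add, add_mul,
      add_mul, hdd, h1, h2]
    have : x * star v * (v * x) = x * (star v * v) * x := by simp only [mul_assoc]
    rw [this, ← hv', show x * e = x from hxe, hxx]
    simp

end Equivalent

/-! ### Families of copies of a projection, and the dimension -/

section Gamma

variable {A : Type u} [CStarAlgebra A] {e f z : A}

theorem dim_zero : dim (0 : A) = 0 := if_pos rfl

theorem IsGamma.injective {I : Type u} {f : I → A} (h : IsGamma e f) (he : e ≠ 0) :
    Function.Injective f := by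
  intro i j hij
  by_contra hne
  have h1 := h.1.2.1 i j hne
  rw [← hij, show f i * f i = f i from (h.1.1 i).isIdempotentElem] at h1
  exact (h.2 i).ne_zero he h1

theorem IsGamma.lt_dim {I : Type u} {f : I → A} (h : IsGamma e f) (he : e ≠ 0) : #I < dim e := by
  rw [dim, if_neg he]
  -- Members of a family are distinct elements of `A`, so the successor of `#A` is a strict bound
  -- and the infimum is attained.
  have hne : {κ : Cardinal.{u} | ∀ (I : Type u) (f : I → A), IsGamma e f → #I < κ}.Nonempty :=
    ⟨Order.succ #A, fun J g hg => Order.lt_succ_of_le (Cardinal.mk_le_of_injective (hg.injective he))⟩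
  exact csInf_mem hne I f h

theorem exists_isGamma_of_lt_dim {c : Cardinal.{u}} (h : c < dim e) :
    ∃ (I : Type u) (f : I → A), IsGamma e f ∧ c ≤ #I := by
  by_cases he : e = 0
  · rw [dim, if_pos he] at h
    exact absurd h not_lt_zero
  · rw [dim, if_neg he] at h
    have h1 := notMem_of_lt_csInf h (OrderBot.bddBelow _)
    simpa using h1

/-- Cutting by a central projection preserves families in `Γ(e)`. -/
theorem IsGamma.central_mul [IsAWStarAlgebra A] {I : Type u} {f : I → A} (h : IsGamma e f)
    (hz : IsCentralProj z) : IsGamma (z * e) fun i => z * f i := by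
  obtain ⟨⟨hf, ho, hs⟩, heq⟩ := h
  refine ⟨⟨fun i => hz.mul_isStarProjection (hf i), fun i j hij => ?_, ?_, ?_, ?_⟩,
    fun i => (heq i).central_mul hz⟩
  · rw [mul_assoc, ← mul_assoc (f i), hz.comm, mul_assoc, ho i j hij, mul_zero, mul_zero]
  · exact hz.mul_isStarProjection hs.1
  · rintro _ ⟨i, rfl⟩
    exact hz.mul_projLE (hs.2.1 _ ⟨i, rfl⟩)
  · intro q hq hfq
    have h1 : e * (z * (1 - q)) = 0 := by
      refine hs.mul_eq_zero ?_
      rintro _ ⟨i, rfl⟩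
      rw [← mul_assoc, hz.comm, mul_sub, mul_one, show z * f i * q = z * f i from hfq _ ⟨i, rfl⟩,
        sub_self]
    rw [← mul_assoc, hz.comm, mul_sub, mul_one, sub_eq_zero] at h1
    exact h1.symm

/-- The remainder of an orthogonal family of copies of `e` below `e` can be absorbed into one of
its members. -/
theorem exists_isGamma_of_orthogonal [IsAWStarAlgebra A] {I : Type u} [Nonempty I] {f : I → A}
    (he : IsStarProjection e) (hf : ∀ i, IsStarProjection (f i)) (hfe : ∀ i, ProjLE (f i) e)
    (ho : ∀ i j, i ≠ j → f i * f j = 0) (heq : ∀ i, Equivalent (f i) e) :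
    ∃ g : I → A, IsGamma e g := by
  classical
  obtain ⟨s, hs⟩ := exists_isProjSup (Set.range f)
  have hfs : ∀ i, ProjLE (f i) s := fun i => hs.2.1 _ ⟨i, rfl⟩
  have hse : ProjLE s e := hs.2.2 e he (by rintro _ ⟨i, rfl⟩; exact hfe i)
  obtain ⟨i₀⟩ := ‹Nonempty I›
  have hr : IsStarProjection (e - s) := isStarProjection_sub hs.1 he hse
  have hfr : ∀ i, f i * (e - s) = 0 := fun i => by
    rw [mul_sub, show f i * e = f i from hfe i, show f i * s = f i from hfs i, sub_self]
  have hrf : ∀ i, (e - s) * f i = 0 := fun i => by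
    have := congrArg star (hfr i)
    rwa [star_mul, (hf i).isSelfAdjoint.star_eq, hr.isSelfAdjoint.star_eq, star_zero] at this
  have hh : IsStarProjection (f i₀ + (e - s)) := isStarProjection_add (hf i₀) hr (hfr i₀)
  have hfh : ProjLE (f i₀) (f i₀ + (e - s)) := by
    rw [ProjLE, mul_add, hfr, add_zero, show f i₀ * f i₀ = f i₀ from (hf i₀).isIdempotentElem]
  have hrh : ProjLE (e - s) (f i₀ + (e - s)) := by
    rw [ProjLE, mul_add, hrf, zero_add]
    exact hr.isIdempotentElem
  have hhe : ProjLE (f i₀ + (e - s)) e := by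
    rw [ProjLE, add_mul, sub_mul, show f i₀ * e = f i₀ from hfe i₀, show s * e = s from hse,
      show e * e = e from he.isIdempotentElem]
  refine ⟨Function.update f i₀ (f i₀ + (e - s)), ⟨fun i => ?_, fun i j hij => ?_, he, ?_, ?_⟩,
    fun i => ?_⟩
  · by_cases hi : i = i₀
    · subst hi; simpa using hh
    · simpa [hi] using hf i
  · by_cases hi : i = i₀
    · subst hi
      rw [Function.update_self, Function.update_of_ne hij.symm, add_mul, ho i j hij, hrf, add_zero]
    · rw [Function.update_of_ne hi]
      by_cases hj : j = i₀
      · subst hj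
        rw [Function.update_self, mul_add, ho i j hij, hfr, add_zero]
      · rw [Function.update_of_ne hj, ho i j hij]
  · rintro _ ⟨i, rfl⟩
    by_cases hi : i = i₀
    · subst hi; simpa using hhe
    · simpa [hi] using hfe i
  · intro q hq hle
    have h0 : ProjLE (f i₀ + (e - s)) q := by
      have := hle _ ⟨i₀, rfl⟩
      rwa [Function.update_self] at this
    have hsq : ProjLE s q := by
      refine hs.2.2 q hq ?_
      rintro _ ⟨i, rfl⟩
      by_cases hi : i = i₀
      · subst hi; exact hfh.trans h0
      · have := hle _ ⟨i, rfl⟩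
        rwa [Function.update_of_ne hi] at this
    have hrq : (e - s) * q = e - s := hrh.trans h0
    rw [sub_mul, show s * q = s from hsq] at hrq
    exact sub_left_injective hrq
  · by_cases hi : i = i₀
    · subst hi
      rw [Function.update_self]
      -- The enlarged member lies between `f i₀ ∼ e` and `e`, so Schröder–Bernstein applies.
      exact (heq i).of_between he hh (hf i) hfh hhe
    · rw [Function.update_of_ne hi]
      exact heq i

/-- A subfamily need not have supremum `e`, but the part lost can be absorbed into one remaining
member; this needs `I` nonempty. -/
theorem IsGamma.exists_of_mk_le [IsAWStarAlgebra A] {I J : Type u} [Nonempty I] {f : J → A}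
    (h : IsGamma e f) (hIJ : #I ≤ #J) : ∃ g : I → A, IsGamma e g := by
  obtain ⟨φ⟩ := hIJ
  exact exists_isGamma_of_orthogonal (f := f ∘ φ) h.1.2.2.1 (fun i => h.1.1 _)
    (fun i => h.1.2.2.2.1 _ ⟨_, rfl⟩) (fun i j hij => h.1.2.1 _ _ (φ.injective.ne hij))
    (fun i => h.2 _)

end Gamma

/-! ### Proper infiniteness: countable families and gluing -/

section ProperlyInfinite

variable {A : Type u} [CStarAlgebra A] {e z : A}

/-- Idempotence of the sum gives `p * q + q * p = 0`; multiplying by `p` on either side shows that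
`p` and `q` commute, so `2 * p * q = 0`. -/
theorem mul_eq_zero_of_isStarProjection_add {p q : A} (hp : IsStarProjection p)
    (hq : IsStarProjection q) (h : IsStarProjection (p + q)) : p * q = 0 := by
  have hpp : p * p = p := hp.isIdempotentElem
  have hqq : q * q = q := hq.isIdempotentElem
  have h1 : p * q + q * p = 0 := by
    have h2 : (p + q) * (p + q) = p + q := h.isIdempotentElem
    rw [mul_add, add_mul, add_mul, hpp, hqq] at h2
    have h3 : p * q + q * p = (p + q * p + (p * q + q)) - (p + q) := by abel
    rw [h3, h2, sub_self]
  have h2 : p * q + p * q * p = 0 := by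
    have := congrArg (p * ·) h1
    simpa only [mul_add, ← mul_assoc, hpp, mul_zero] using this
  have h3 : p * q * p + q * p = 0 := by
    have := congrArg (· * p) h1
    simpa only [add_mul, mul_assoc, hpp, zero_mul] using this
  have h4 : p * q = q * p := by
    rw [eq_neg_of_add_eq_zero_left h2, eq_neg_of_add_eq_zero_right h3]
  rw [← h4, ← two_smul ℂ] at h1
  exact (smul_eq_zero.1 h1).resolve_left two_ne_zero

/-- A properly infinite projection contains two orthogonal copies of itself. -/
theorem IsProperlyInfinite.exists_isometries (h : IsProperlyInfinite e) :
    ∃ s t : A, star s * s = e ∧ star t * t = e ∧ e * s = s ∧ e * t = t ∧ star s * t = 0 := by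
  obtain ⟨he, -, e₁, e₂, h₁, h₂, h12, h2e, hadd⟩ := h
  obtain ⟨s, hs, hs'⟩ := h12.trans h₂ h2e
  obtain ⟨t, ht, ht'⟩ := h2e
  have ho : e₁ * e₂ = 0 := mul_eq_zero_of_isStarProjection_add h₁ h₂ (hadd ▸ he)
  have ho' : e₂ * e₁ = 0 := mul_eq_zero_of_isStarProjection_add h₂ h₁ (by rw [add_comm]; exact hadd ▸ he)
  have h1s : e₁ * s = s := by
    rw [hs, mul_assoc, ← hs', mul_eq_self_of_star_mul_self he hs'.symm]
  have h2t : e₂ * t = t := by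
    rw [ht, mul_assoc, ← ht', mul_eq_self_of_star_mul_self he ht'.symm]
  have hss : star s * e₁ = star s := by
    have := congrArg star h1s
    rwa [star_mul, h₁.isSelfAdjoint.star_eq] at this
  refine ⟨s, t, hs'.symm, ht'.symm, ?_, ?_, ?_⟩
  · rw [hadd, ← h1s, ← mul_assoc, add_mul, show e₁ * e₁ = e₁ from h₁.isIdempotentElem, ho',
      add_zero]
  · rw [hadd, ← h2t, ← mul_assoc, add_mul, show e₂ * e₂ = e₂ from h₂.isIdempotentElem, ho,
      zero_add]
  · rw [← hss, ← h2t, mul_assoc, ← mul_assoc e₁, ho, zero_mul, mul_zero]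

theorem IsProperlyInfinite.central_mul (h : IsProperlyInfinite e) (hz : IsCentralProj z)
    (h0 : z * e ≠ 0) : IsProperlyInfinite (z * e) := by
  obtain ⟨he, -, e₁, e₂, h₁, h₂, h12, h2e, hadd⟩ := h
  exact ⟨hz.mul_isStarProjection he, h0, z * e₁, z * e₂, hz.mul_isStarProjection h₁,
    hz.mul_isStarProjection h₂, h12.central_mul hz, h2e.central_mul hz, by rw [hadd, mul_add]⟩

/-- With `s`, `t` isometries of `e` onto orthogonal copies, the elements `s ^ n * t` have pairwise
orthogonal ranges, each a copy of `e`. -/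
theorem IsProperlyInfinite.exists_isGamma_nat [IsAWStarAlgebra A] (h : IsProperlyInfinite e) :
    ∃ f : ULift.{u} ℕ → A, IsGamma e f := by
  obtain ⟨s, t, hs, ht, hes, het, hst⟩ := h.exists_isometries
  have he := h.1
  have hts : star t * s = 0 := by
    have := congrArg star hst
    rwa [star_mul, star_star, star_zero] at this
  let w : ℕ → A := fun n => s ^ n * t
  have hw : ∀ n, e * w n = w n := fun n => by
    cases n with
    | zero => simp [w, het]
    | succ n => simp only [w, pow_succ', mul_assoc]; rw [← mul_assoc e, hes]
  have hsw : ∀ n, star s * w (n + 1) = w n := fun n => by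
    rw [← hw n, ← hs]; simp only [w, pow_succ', mul_assoc]
  have hww : ∀ n, star (w n) * w n = e := fun n => by
    induction n with
    | zero => simp [w, ht]
    | succ n ih =>
      have : star (w (n + 1)) = star (w n) * star s := by
        simp only [w, pow_succ', star_mul, mul_assoc]
      rw [this, mul_assoc, hsw, ih]
  have hlt : ∀ n k, star (w n) * w (n + k + 1) = 0 := fun n k => by
    induction n with
    | zero => simp only [w, pow_succ', pow_zero, one_mul, ← mul_assoc, hts, zero_mul]
    | succ n ih =>
      have : star (w (n + 1)) = star (w n) * star s := by
        simp only [w, pow_succ', star_mul, mul_assoc]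
      rw [this, mul_assoc, hsw, show n + 1 + k = n + k + 1 by omega, ih]
  have hne : ∀ m n, m ≠ n → star (w m) * w n = 0 := fun m n hmn => by
    rcases lt_or_gt_of_ne hmn with hl | hl
    · obtain ⟨k, rfl⟩ := Nat.exists_eq_add_of_lt hl
      exact hlt m k
    · obtain ⟨k, rfl⟩ := Nat.exists_eq_add_of_lt hl
      have := congrArg star (hlt n k)
      rwa [star_mul, star_star, star_zero] at this
  have hproj : ∀ n, IsStarProjection (w n * star (w n)) := fun n =>
    isStarProjection_mul_star_self he (hww n)
  refine exists_isGamma_of_orthogonal (f := fun n => w n.down * star (w n.down)) he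
    (fun n => hproj _) (fun n => ?_) (fun m n hmn => ?_) (fun n => ⟨w n.down, rfl, (hww _).symm⟩)
  · have h1 : ProjLE (w n.down * star (w n.down)) e := by
      have := congrArg star (show e * (w n.down * star (w n.down)) = w n.down * star (w n.down) by
        rw [← mul_assoc, hw])
      rwa [star_mul, (hproj _).isSelfAdjoint.star_eq, he.isSelfAdjoint.star_eq] at this
    exact h1
  · have : m.down ≠ n.down := fun h => hmn (ULift.ext _ _ h)
    rw [mul_assoc, ← mul_assoc (star _), hne _ _ this, zero_mul, mul_zero]

/-- Partial isometries with initial projections `z i * e`, for orthogonal central `z i`, glue. -/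
theorem IsProperlyInfinite.exists_glue [IsAWStarAlgebra A] (h : IsProperlyInfinite e)
    {ι : Type v} {z v : ι → A} {y : A} (hz : ∀ i, IsCentralProj (z i))
    (ho : ∀ i j, i ≠ j → z i * z j = 0) (hy : IsProjSup (Set.range z) y)
    (hv : ∀ i, star (v i) * v i = z i * e) (hev : ∀ i, e * v i = v i)
    (hzv : ∀ i, z i * v i = v i) :
    ∃ w : A, star w * w = y * e ∧ e * w = w ∧ y * w = w ∧ ∀ i, z i * w = v i := by
  obtain ⟨s, t, hs, ht, hes, het, hst⟩ := h.exists_isometries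
  have he := h.1
  have hee : e * e = e := he.isIdempotentElem
  have hte := mul_eq_self_of_star_mul_self he ht
  have het' : e * star t = star t := by
    have := congrArg star hte
    rwa [star_mul, he.isSelfAdjoint.star_eq] at this
  have hts : star t * s = 0 := by
    have := congrArg star hst
    rwa [star_mul, star_star, star_zero] at this
  have hze : ∀ i, IsStarProjection (z i * e) := fun i => (hz i).mul_isStarProjection he
  have hvz : ∀ i, v i * (z i * e) = v i := fun i => mul_eq_self_of_star_mul_self (hze i) (hv i)
  have hve : ∀ i, v i * e = v i := fun i => by
    rw [← hvz i, mul_assoc, mul_assoc, hee]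
  have hyc : IsCentralProj y := hy.isCentralProj (by rintro _ ⟨i, rfl⟩; exact hz i)
  -- Moving `v i` off the diagonal: `w i` goes from the copy `s * star s` to the orthogonal copy `t
  -- * star t`, so it squares to zero.
  let w : ι → A := fun i => t * v i * star s
  have hws : ∀ i, star (w i) = s * star (v i) * star t := fun i => by
    simp only [w, star_mul, star_star, mul_assoc]
  have hwz : ∀ i, w i * z i = w i := fun i => by
    rw [(hz i).comm]
    change z i * (t * v i * star s) = t * v i * star s
    rw [← mul_assoc, ← mul_assoc, ← (hz i).comm t, mul_assoc t, hzv]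
  have hzw : ∀ i, z i * star (w i) = star (w i) := fun i => by
    have := congrArg star (hwz i)
    rwa [star_mul, (hz i).1.isSelfAdjoint.star_eq] at this
  have hww0 : ∀ i, w i * w i = 0 := fun i => by
    calc w i * w i = t * v i * (star s * t) * v i * star s := by simp only [w, mul_assoc]
      _ = 0 := by rw [hst]; simp
  have hww0' : ∀ i, star (w i) * star (w i) = 0 := fun i => by
    rw [← star_mul, hww0, star_zero]
  have hww : ∀ i, star (w i) * w i = s * (z i * e) * star s := fun i => by
    calc star (w i) * w i = s * star (v i) * (star t * t) * v i * star s := by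
          rw [hws]; simp only [w, mul_assoc]
      _ = s * (star (v i) * v i) * star s := by
          rw [ht, mul_assoc (s * star (v i)), hev]; simp only [mul_assoc]
      _ = _ := by rw [hv]
  have hwww : ∀ i, w i * (star (w i) * w i) = w i := fun i => by
    rw [hww]
    calc t * v i * star s * (s * (z i * e) * star s)
        = t * v i * (star s * s) * (z i * e) * star s := by simp only [mul_assoc]
      _ = t * v i * star s := by
        rw [hs, mul_assoc t (v i) e, hve, mul_assoc t, hvz]
  have hwww' : ∀ i, star (w i) * (w i * star (w i)) = star (w i) := fun i => by
    have := congrArg star (hwww i)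
    simpa only [star_mul, star_star, mul_assoc] using this
  -- The projection onto the graph of `w i`. Its off-diagonal corner is half of `w i`, so it
  -- remembers `v i`, and unlike partial isometries these projections have a supremum.
  let g : ι → A := fun i =>
    (2⁻¹ : ℂ) • (w i * star (w i) + star (w i) * w i + w i + star (w i))
  have hg : ∀ i, IsStarProjection (g i) := fun i => by
    refine ⟨?_, ?_⟩
    · have key : (w i * star (w i) + star (w i) * w i + w i + star (w i)) *
          (w i * star (w i) + star (w i) * w i + w i + star (w i)) =
          (2 : ℂ) • (w i * star (w i) + star (w i) * w i + w i + star (w i)) := by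
        have r1 : ∀ a, w i * (w i * a) = 0 := fun a => by rw [← mul_assoc, hww0, zero_mul]
        have r2 : ∀ a, star (w i) * (star (w i) * a) = 0 := fun a => by
          rw [← mul_assoc, hww0', zero_mul]
        simp only [mul_add, add_mul, mul_assoc, r1, r2, hwww, hwww', hww0, hww0',
          mul_zero, two_smul]
        abel
      change (2⁻¹ : ℂ) • _ * ((2⁻¹ : ℂ) • _) = (2⁻¹ : ℂ) • _
      rw [smul_mul_smul_comm, key, smul_smul]
      norm_num
    · have h2 : star (2⁻¹ : ℂ) = 2⁻¹ := by simp
      simp only [g, IsSelfAdjoint, star_smul, star_add, star_mul, star_star, h2]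
      congr 1
      abel
  have hgz : ∀ i, ProjLE (g i) (z i) := fun i => by
    have h1 : star (w i) * z i = star (w i) := by rw [(hz i).comm, hzw]
    simp only [ProjLE, g, smul_mul_assoc, add_mul, mul_assoc, h1, hwz]
  obtain ⟨p, hp⟩ := exists_isProjSup (Set.range g)
  have hzp : ∀ i, z i * p = g i := hp.central_mul_eq hz ho hg hgz
  have hzy : ∀ i, z i * y = z i := fun i => hy.2.1 _ ⟨i, rfl⟩
  have key : ∀ i, (2 : ℂ) • (star t * g i * s) = v i := fun i => by
    have h1 : star t * (w i * star (w i) + star (w i) * w i + w i + star (w i)) * s = v i := by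
      have a1 : star t * (w i * star (w i)) * s = 0 := by
        calc star t * (w i * star (w i)) * s = star t * w i * s * star (v i) * (star t * s) := by
              rw [hws]; simp only [mul_assoc]
          _ = 0 := by rw [hts, mul_zero]
      have a2 : star t * (star (w i) * w i) * s = 0 := by
        rw [hww]
        calc star t * (s * (z i * e) * star s) * s = (star t * s) * (z i * e) * star s * s := by
              simp only [mul_assoc]
          _ = 0 := by rw [hts]; simp
      have a3 : star t * star (w i) * s = 0 := by
        rw [hws]
        calc star t * (s * star (v i) * star t) * s = (star t * s) * star (v i) * star t * s := by
              simp only [mul_assoc]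
          _ = 0 := by rw [hts]; simp
      have a4 : star t * w i * s = v i := by
        calc star t * (t * v i * star s) * s = (star t * t) * v i * (star s * s) := by
              simp only [mul_assoc]
          _ = v i := by rw [ht, hs, hev, hve]
      simp only [mul_add, add_mul, a1, a2, a3, a4]
      simp
    simp only [g, mul_smul_comm, smul_mul_assoc, h1, smul_smul]
    norm_num
  -- Read the glued element off the corner of `p`; the factor `2` undoes the `2⁻¹` in `g`.
  let x : A := y * ((2 : ℂ) • (star t * p * s))
  have hzx : ∀ i, z i * x = v i := fun i => by
    rw [← key i, ← hzp i]
    change z i * (y * _) = _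
    rw [← mul_assoc, hzy, mul_smul_comm]
    congr 1
    rw [← mul_assoc, ← mul_assoc, ← mul_assoc, ← (hz i).comm (star t)]
  have hyx : y * x = x := by
    change y * (y * _) = y * _
    rw [← mul_assoc, show y * y = y from hyc.1.isIdempotentElem]
  have hex : e * x = x := by
    change e * (y * _) = y * _
    rw [← mul_assoc, hyc.comm, mul_assoc, mul_smul_comm, mul_assoc (star t), ← mul_assoc e, het']
  clear_value x
  have h1 : y * (star x * x) = y * e := by
    refine hy.mul_eq_mul ?_
    rintro _ ⟨i, rfl⟩
    rw [← hv, ← hzx, star_mul, (hz i).1.isSelfAdjoint.star_eq, ← mul_assoc, ← (hz i).comm,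
      mul_assoc, mul_assoc, ← mul_assoc (z i) (z i), show z i * z i = z i from
      (hz i).1.isIdempotentElem]
  exact ⟨x, by rw [← h1, ← mul_assoc, ← hyc.comm, mul_assoc, hyx], hex, hyx, hzx⟩

end ProperlyInfinite

/-! ### Central thresholds for the dimension -/

section Decomposition

variable {A : Type u} [CStarAlgebra A] [IsAWStarAlgebra A] {e y z w : A}

/-- For each index `k`, glue over `i` the partial isometries implementing `f i k ∼ z i * e`.
Orthogonality and the supremum property are then checked after cutting by each `z i`. -/
theorem IsProperlyInfinite.exists_isGamma_of_sup (h : IsProperlyInfinite e) {I : Type u}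
    {ι : Type v} {z : ι → A} {f : ι → I → A} (hz : ∀ i, IsCentralProj (z i))
    (ho : ∀ i j, i ≠ j → z i * z j = 0) (hy : IsProjSup (Set.range z) y)
    (hf : ∀ i, IsGamma (z i * e) (f i)) : ∃ g : I → A, IsGamma (y * e) g := by
  have he := h.1
  have hyc : IsCentralProj y := hy.isCentralProj (by rintro _ ⟨i, rfl⟩; exact hz i)
  have hye := hyc.mul_isStarProjection he
  choose v hv hv' using fun i k => (hf i).2 k
  have hzv : ∀ i k, (z i * e) * v i k = v i k := fun i k => by
    have hze := (hz i).mul_isStarProjection he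
    have h1 : f i k * v i k = v i k := by
      rw [hv, mul_assoc, ← hv', mul_eq_self_of_star_mul_self hze (hv' i k).symm]
    have h2 : ProjLE (f i k) (z i * e) := (hf i).1.2.2.2.1 _ ⟨k, rfl⟩
    rw [← h1, ← mul_assoc, h2.mul_eq_right ((hf i).1.1 k) hze]
  choose w hw hew hyw hzw using fun k => h.exists_glue (v := fun i => v i k) hz ho hy
    (fun i => (hv' i k).symm)
    (fun i => by rw [← hzv i k, ← mul_assoc, ← mul_assoc, (hz i).comm, mul_assoc (z i),
      show e * e = e from he.isIdempotentElem])
    (fun i => by rw [← hzv i k, ← mul_assoc, ← mul_assoc,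
      show z i * z i = z i from (hz i).1.isIdempotentElem])
  have hzf : ∀ i k, z i * (w k * star (w k)) = f i k := fun i k => by
    rw [hv, ← hzw k i, star_mul, (hz i).1.isSelfAdjoint.star_eq, (hz i).comm,
      (hz i).mul_mul_mul]
  have hp : ∀ k, IsStarProjection (w k * star (w k)) := fun k =>
    isStarProjection_mul_star_self hye (hw k)
  have hyp : ∀ k, (y * e) * (w k * star (w k)) = w k * star (w k) := fun k => by
    rw [← mul_assoc, mul_assoc y, hew, hyw]
  refine ⟨fun k => w k * star (w k), ⟨hp, fun k l hkl => ?_, hye, ?_, ?_⟩,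
    fun k => ⟨w k, rfl, (hw k).symm⟩⟩
  · have h1 : y * ((w k * star (w k)) * (w l * star (w l))) = 0 := by
      refine hy.mul_eq_zero ?_
      rintro _ ⟨i, rfl⟩
      rw [← (hz i).mul_mul_mul, hzf, hzf, (hf i).1.2.1 k l hkl]
    rwa [← mul_assoc, ← mul_assoc y, hyw] at h1
  · rintro _ ⟨k, rfl⟩
    have := congrArg star (hyp k)
    rwa [star_mul, hye.isSelfAdjoint.star_eq, (hp k).isSelfAdjoint.star_eq] at this
  · intro q hq hle
    have h1 : y * (e * q) = y * e := by
      refine hy.mul_eq_mul ?_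
      rintro _ ⟨i, rfl⟩
      have h2 : ProjLE (z i * e) (z i * q) := by
        refine (hf i).1.2.2.2.2 _ ((hz i).mul_isStarProjection hq) ?_
        rintro _ ⟨k, rfl⟩
        rw [← hzf]
        exact (hz i).mul_projLE (hle _ ⟨k, rfl⟩)
      have h3 : z i * q * q = z i * q := by
        rw [mul_assoc, show q * q = q from hq.isIdempotentElem]
      have h4 : ProjLE (z i * e) q := h2.trans h3
      rw [← mul_assoc]
      exact h4
    rw [ProjLE, mul_assoc, h1]

/-- Among the central projections `z` for which `Γ(z * e)` contains a family indexed by `I` there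
is a largest one. -/
theorem IsProperlyInfinite.exists_largest_isGamma (h : IsProperlyInfinite e) (I : Type u) :
    ∃ y : A, IsCentralProj y ∧ ∀ z : A, IsCentralProj z →
      ((∃ f : I → A, IsGamma (z * e) f) ↔ ProjLE z y) := by
  let P : A → Prop := fun z => IsCentralProj z ∧ ∃ f : I → A, IsGamma (z * e) f
  have hP : ∀ z w, IsCentralProj z → P w → P (z * w) := by
    rintro z w hz ⟨hw, f, hf⟩
    exact ⟨hz.mul hw, fun i => z * f i, by rw [mul_assoc]; exact hf.central_mul hz⟩
  obtain ⟨S, hS⟩ := zorn_subset {S : Set A | (∀ z ∈ S, P z) ∧ S.Pairwise fun a b => a * b = 0} (by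
    intro c hc hchain
    refine ⟨⋃₀ c, ⟨?_, ?_⟩, fun s hs => Set.subset_sUnion_of_mem hs⟩
    · rintro z ⟨s, hs, hzs⟩
      exact (hc hs).1 z hzs
    · exact (Set.pairwise_sUnion hchain.directedOn).2 fun s hs => (hc hs).2)
  obtain ⟨y, hy⟩ := exists_isProjSup S
  have hyc : IsCentralProj y := hy.isCentralProj fun s hs => (hS.prop.1 s hs).1
  choose f hf using fun s : S => (hS.prop.1 s.1 s.2).2
  have hPy : P y := ⟨hyc, h.exists_isGamma_of_sup (z := fun s : S => s.1)
    (fun s => (hS.prop.1 s.1 s.2).1)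
    (fun s t hst => hS.prop.2 s.2 t.2 fun hh => hst (Subtype.ext hh))
    (by rwa [Subtype.range_coe]) hf⟩
  refine ⟨y, hyc, fun z hz => ⟨fun hzf => ?_, fun hzy => ?_⟩⟩
  · have hPz : P ((1 - y) * z) := hP _ _ hyc.one_sub ⟨hz, hzf⟩
    have ho : ∀ s ∈ S, s * ((1 - y) * z) = 0 := fun s hs => by
      rw [← mul_assoc, mul_sub, mul_one, show s * y = s from hy.2.1 s hs, sub_self, zero_mul]
    have hmem : (1 - y) * z ∈ S := by
      refine hS.mem_of_prop_insert ⟨?_, ?_⟩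
      · rintro s (rfl | hs)
        · exact hPz
        · exact hS.prop.1 s hs
      · refine hS.prop.2.insert fun s hs _ => ⟨?_, ho s hs⟩
        rw [(hS.prop.1 s hs).1.comm, ho s hs]
    have h1 : (1 - y) * z * y = (1 - y) * z := hy.2.1 _ hmem
    have h2 : (1 - y) * z = 0 := by
      rw [← h1, mul_assoc, hyc.comm z, ← mul_assoc, sub_mul, one_mul,
        show y * y = y from hyc.1.isIdempotentElem, sub_self, zero_mul]
    rw [sub_mul, one_mul, sub_eq_zero] at h2
    rw [ProjLE, hyc.comm]
    exact h2.symm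
  · rw [← show z * y = z from hzy]
    exact (hP z y hz hPy).2

/-- A larger family shrinks to one of size exactly `c`. The case `c = 0` must be excluded: an empty
family cannot have the nonzero supremum `e`. -/
theorem IsProperlyInfinite.lt_dim_iff (h : IsProperlyInfinite e) {c : Cardinal.{u}} (hc : c ≠ 0) :
    c < dim e ↔ ∃ f : c.out → A, IsGamma e f := by
  refine ⟨fun hlt => ?_, fun ⟨f, hf⟩ => ?_⟩
  · obtain ⟨J, f, hf, hJ⟩ := exists_isGamma_of_lt_dim hlt
    have : Nonempty c.out := by rwa [← Cardinal.mk_ne_zero_iff, Cardinal.mk_out]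
    exact hf.exists_of_mk_le (by rwa [Cardinal.mk_out])
  · simpa using hf.lt_dim h.2.1

theorem IsProperlyInfinite.aleph0_lt_dim (h : IsProperlyInfinite e) : ℵ₀ < dim e := by
  obtain ⟨f, hf⟩ := h.exists_isGamma_nat
  simpa using hf.lt_dim h.2.1

/-- If `z * e = 0` then `1 - z` is a central projection above `e`, hence above its central cover. -/
theorem eq_zero_of_mul_eq_zero (hz : IsCentralProj z) (hze : ProjLE z (centralCover e))
    (h : z * e = 0) : z = 0 := by
  have h1 : ProjLE (centralCover e) (1 - z) :=
    (centralCover_spec e).2.2 _ hz.one_sub (projLE_one_sub_iff.2 (by rw [hz.comm, h]))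
  have h2 : z * (1 - z) = z := hze.trans h1
  rw [← h2, mul_sub, mul_one, show z * z = z from hz.1.isIdempotentElem, sub_self]

theorem centralCover_mul_eq (he : IsStarProjection e) (hz : IsCentralProj z)
    (hze : ProjLE z (centralCover e)) : centralCover (z * e) = z := by
  obtain ⟨hc, hle, hleast⟩ := centralCover_spec (z * e)
  refine (hleast z hz (hz.mul_left_projLE e)).antisymm hc.1 hz.1 ?_
  have h1 : (1 - centralCover (z * e)) * z = 0 := by
    refine eq_zero_of_mul_eq_zero (e := e) (hc.one_sub.mul hz) ?_ ?_
    · rw [ProjLE, mul_assoc, show z * centralCover e = z from hze]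
    · rw [mul_assoc, sub_mul, one_mul, hle.mul_eq_right (hz.mul_isStarProjection he) hc.1, sub_self]
  rw [sub_mul, one_mul, sub_eq_zero] at h1
  rw [ProjLE, hc.comm]
  exact h1.symm

theorem IsProperlyInfinite.of_le_centralCover (h : IsProperlyInfinite e) (hz : IsCentralProj z)
    (hze : ProjLE z (centralCover e)) (h0 : z ≠ 0) : IsProperlyInfinite (z * e) :=
  h.central_mul hz fun hh => h0 (eq_zero_of_mul_eq_zero hz hze hh)

theorem dim_mul_le_dimBar (hz : IsCentralProj z) (hze : ProjLE z (centralCover e)) (h0 : z ≠ 0) :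
    dim (z * e) ≤ dimBar e :=
  le_ciSup (f := fun z : {z : A // IsCentralProj z ∧ z ≠ 0 ∧ ProjLE z (centralCover e)} =>
    dim (z.1 * e)) Cardinal.bddAbove_of_small ⟨z, hz, h0, hze⟩

/-- The central projections bounding the dimension of the central cut-downs of `e`. -/
theorem IsProperlyInfinite.exists_lt_dim_iff (h : IsProperlyInfinite e) :
    ∃ y : Cardinal.{u} → A, (∀ c, IsCentralProj (y c)) ∧ ∀ c, c ≠ 0 → ∀ z, IsCentralProj z →
      ProjLE z (centralCover e) → z ≠ 0 → (c < dim (z * e) ↔ ProjLE z (y c)) := by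
  choose y hy hiff using fun c : Cardinal.{u} => h.exists_largest_isGamma c.out
  exact ⟨y, hy, fun c hc z hz hze h0 =>
    ((h.of_le_centralCover hz hze h0).lt_dim_iff hc).trans (hiff c z hz)⟩

/-- The bounds `w ≤ y c` say that every nonzero central piece has dimension at least `α`, and `w * y
α = 0` that none exceeds `α`. Infinite `c` suffice because all these dimensions are infinite. -/
theorem IsProperlyInfinite.isEquidimensionalOf_iff (h : IsProperlyInfinite e)
    {y : Cardinal.{u} → A} (hyc : ∀ c, IsCentralProj (y c))
    (hy : ∀ c, c ≠ 0 → ∀ z, IsCentralProj z → ProjLE z (centralCover e) → z ≠ 0 →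
      (c < dim (z * e) ↔ ProjLE z (y c)))
    {α : Cardinal.{u}} (hα : ℵ₀ ≤ α) (hw : IsCentralProj w) (hwe : ProjLE w (centralCover e)) :
    IsEquidimensionalOf α (w * e) ↔
      w ≠ 0 ∧ (∀ c, ℵ₀ ≤ c → c < α → ProjLE w (y c)) ∧ w * y α = 0 := by
  have hne : ∀ {c : Cardinal.{u}}, ℵ₀ ≤ c → c ≠ 0 := fun hc =>
    (Cardinal.aleph0_pos.trans_le hc).ne'
  constructor
  · rintro ⟨heq, hdim⟩
    have hw0 : w ≠ 0 := by
      rintro rfl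
      rw [zero_mul, dim_zero] at hdim
      exact hne hα hdim.symm
    refine ⟨hw0, fun c hc hcα => (hy c (hne hc) w hw hwe hw0).1 (hdim ▸ hcα), ?_⟩
    by_contra h0
    rcases heq with heq | ⟨-, heq⟩
    · exact hw0 (eq_zero_of_mul_eq_zero hw hwe heq)
    · have hle : ProjLE (w * y α) w := hw.mul_left_projLE _
      have hdim' := heq (w * y α) (hw.mul (hyc α)) h0
        (by rwa [centralCover_mul_eq h.1 hw hwe])
      rw [← mul_assoc, show w * y α * w = w * y α from hle, hdim] at hdim'
      have := (hy α (hne hα) _ (hw.mul (hyc α)) (hle.trans hwe) h0).2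
        (by rw [ProjLE, mul_assoc, show y α * y α = y α from (hyc α).1.isIdempotentElem])
      exact this.ne hdim'.symm
  · rintro ⟨hw0, hlow, hup⟩
    have key : ∀ x, IsCentralProj x → x ≠ 0 → ProjLE x w → dim (x * e) = α := by
      intro x hx hx0 hxw
      have hxe := hxw.trans hwe
      refine le_antisymm (not_lt.1 fun hlt => hx0 ?_) (not_lt.1 fun hlt => ?_)
      · have h1 : x * y α = x := (hy α (hne hα) x hx hxe hx0).1 hlt
        rw [← h1, ← show x * w = x from hxw, mul_assoc, hup, mul_zero]
      · have hinf := (h.of_le_centralCover hx hxe hx0).aleph0_lt_dim.le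
        -- Take `c` to be `dim (x * e)` itself: if it were below `α`, then `x ≤ y c` would give `c <
        -- c`.
        exact lt_irrefl _ ((hy _ (hne hinf) x hx hxe hx0).2 (hxw.trans (hlow _ hinf hlt)))
    have hdim := key w hw hw0 (projLE_refl hw.1)
    refine ⟨Or.inr ⟨h.of_le_centralCover hw hwe hw0, fun x hx hx0 hxw => ?_⟩, hdim⟩
    rw [centralCover_mul_eq h.1 hw hwe] at hxw
    rw [hdim, ← mul_assoc, show x * w = x from hxw, key x hx hx0 hxw]

end Decomposition

end AWStar

/-! ### The equidimensional decomposition -/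

theorem theorem5p6 {A : Type u} [CStarAlgebra A] [IsAWStarAlgebra A] (e : A)
    (he : AWStar.IsProperlyInfinite e) :
    ∃ z : Set.Icc ℵ₀ (AWStar.dimBar e) → A,
      -- `z α` is the largest central projection below the central cover of `e` for which
      -- `z α * e` is `α`-equidimensional, and it is `0` if there is none
      (∀ α, AWStar.IsCentralProj (z α) ∧ AWStar.ProjLE (z α) (AWStar.centralCover e) ∧
        (z α = 0 ∨ AWStar.IsEquidimensionalOf α.1 (z α * e)) ∧
        ∀ w : A, AWStar.IsCentralProj w → AWStar.ProjLE w (AWStar.centralCover e) →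
          AWStar.IsEquidimensionalOf α.1 (w * e) → AWStar.ProjLE w (z α)) ∧
      -- orthogonality for distinct cardinals
      (∀ α β, α ≠ β → z α * z β = 0) ∧
      -- the central cover of `e` is the sum of the `z α`
      AWStar.IsProjSum z (AWStar.centralCover e) ∧
      -- `e` is the sum of the equidimensional projections `z α * e`
      (∀ α, AWStar.IsEquidimensional (z α * e)) ∧
      AWStar.IsProjSum (fun α => z α * e) e := by
  open AWStar in
  obtain ⟨y, hyc, hy⟩ := he.exists_lt_dim_iff
  have hiff := fun {α : Cardinal.{u}} (hα : ℵ₀ ≤ α) {w : A} =>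
    he.isEquidimensionalOf_iff (w := w) hyc hy hα
  obtain ⟨hC, heC, -⟩ := centralCover_spec e
  -- If no `w` qualifies, this is the supremum of the empty set, namely `0`.
  choose z hz using fun α : Set.Icc ℵ₀ (dimBar e) => exists_isProjSup
    {w : A | IsCentralProj w ∧ ProjLE w (centralCover e) ∧ IsEquidimensionalOf α.1 (w * e)}
  have hzc : ∀ α, IsCentralProj (z α) := fun α => (hz α).isCentralProj fun w hw => hw.1
  have hzC : ∀ α, ProjLE (z α) (centralCover e) := fun α => (hz α).2.2 _ hC.1 fun w hw => hw.2.1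
  have hzlow : ∀ α c, ℵ₀ ≤ c → c < α.1 → ProjLE (z α) (y c) := fun α c hc hcα =>
    (hz α).2.2 _ (hyc c).1 fun w hw => ((hiff α.2.1 hw.1 hw.2.1).1 hw.2.2).2.1 c hc hcα
  have hzup : ∀ α, z α * y α.1 = 0 := fun α =>
    (hz α).mul_eq_zero fun w hw => ((hiff α.2.1 hw.1 hw.2.1).1 hw.2.2).2.2
  have hzeq : ∀ α, z α = 0 ∨ IsEquidimensionalOf α.1 (z α * e) := fun α =>
    or_iff_not_imp_left.2 fun h0 =>
      (hiff α.2.1 (hzc α) (hzC α)).2 ⟨h0, hzlow α, hzup α⟩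
  have hlt : ∀ α β, α < β → z α * z β = 0 := fun α β hαβ => by
    rw [← show z β * y α.1 = z β from hzlow β α.1 α.2.1 hαβ, (hyc α.1).comm, ← mul_assoc, hzup,
      zero_mul]
  have ho : ∀ α β, α ≠ β → z α * z β = 0 := fun α β hαβ => by
    rcases lt_or_gt_of_ne hαβ with hl | hl
    · exact hlt α β hl
    · rw [(hzc β).comm, hlt β α hl]
  have hsup : IsProjSup (Set.range z) (centralCover e) := by
    obtain ⟨s, hs⟩ := exists_isProjSup (Set.range z)
    have hsc : IsCentralProj s := hs.isCentralProj (by rintro _ ⟨α, rfl⟩; exact hzc α)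
    have hsC : ProjLE s (centralCover e) := hs.2.2 _ hC.1 (by rintro _ ⟨α, rfl⟩; exact hzC α)
    have hp : IsCentralProj ((1 - s) * centralCover e) := hsc.one_sub.mul hC
    have hpC : ProjLE ((1 - s) * centralCover e) (centralCover e) := by
      rw [ProjLE, mul_assoc, show centralCover e * centralCover e = _ from hC.1.isIdempotentElem]
    have h0 : (1 - s) * centralCover e = 0 := by
      by_contra h0
      set p := (1 - s) * centralCover e with hpdef
      have hinf := (he.of_le_centralCover hp hpC h0).aleph0_lt_dim.le
      have hex : ∃ c, ℵ₀ ≤ c ∧ ¬ ProjLE p (y c) := ⟨dim (p * e), hinf, fun hle => lt_irrefl _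
        ((hy _ (Cardinal.aleph0_pos.trans_le hinf).ne' p hp hpC h0).2 hle)⟩
      -- Minimality of `c` puts `p` below every earlier threshold, so cutting `p` by `1 - y c`
      -- leaves a `c`-equidimensional piece.
      obtain ⟨c, ⟨hc, hpc⟩, hmin⟩ := WellFounded.has_min
        (wellFounded_lt (α := Cardinal.{u})) {c | ℵ₀ ≤ c ∧ ¬ ProjLE p (y c)} hex
      have hw : IsCentralProj (p * (1 - y c)) := hp.mul (hyc c).one_sub
      have hwp : ProjLE (p * (1 - y c)) p := hp.mul_left_projLE _
      have hwC := hwp.trans hpC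
      have hw0 : p * (1 - y c) ≠ 0 := fun hh => hpc (by
        rw [mul_sub, mul_one, sub_eq_zero] at hh
        exact hh.symm)
      have hwE : IsEquidimensionalOf c (p * (1 - y c) * e) := by
        refine (hiff hc hw hwC).2 ⟨hw0, fun c' hc' hlt => hwp.trans ?_, ?_⟩
        · by_contra hn
          exact hmin c' ⟨hc', hn⟩ hlt
        · rw [mul_assoc, sub_mul, one_mul, show y c * y c = y c from (hyc c).1.isIdempotentElem,
            sub_self, mul_zero]
      -- Since `c` is the dimension of a central piece of `e`, it lies in the index range, so that
      -- piece is below `z` at `c` and hence below `s`.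
      have hcd : c ≤ dimBar e := hwE.2 ▸ dim_mul_le_dimBar hw hwC hw0
      have hws : p * (1 - y c) * s = p * (1 - y c) :=
        ((hz ⟨c, hc, hcd⟩).2.1 _ ⟨hw, hwC, hwE⟩).trans (hs.2.1 _ ⟨_, rfl⟩)
      have hps : p * s = 0 := by
        rw [hpdef, hsc.comm, ← mul_assoc, mul_sub, mul_one,
          show s * s = s from hsc.1.isIdempotentElem, sub_self, zero_mul]
      exact hw0 (by rw [← hws, mul_assoc, hsc.comm, ← mul_assoc, hps, zero_mul])
    rw [sub_mul, one_mul, sub_eq_zero, show s * centralCover e = s from hsC] at h0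
    exact h0 ▸ hs
  refine ⟨z, fun α => ⟨hzc α, hzC α, hzeq α, fun w hw hwC hwE => (hz α).2.1 w ⟨hw, hwC, hwE⟩⟩,
    ho, ⟨fun α => (hzc α).1, ho, hsup⟩, fun α => ?_,
    fun α => (hzc α).mul_isStarProjection he.1, fun α β hαβ => ?_, he.1, ?_, fun q hq hle => ?_⟩
  · rcases hzeq α with h0 | h0
    · exact Or.inl (by rw [h0, zero_mul])
    · exact h0.1
  · change z α * e * (z β * e) = 0
    rw [← mul_assoc, mul_assoc (z α), (hzc β).comm, ← mul_assoc, ho α β hαβ,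
      zero_mul, zero_mul]
  · rintro _ ⟨α, rfl⟩
    change z α * e * e = z α * e
    rw [mul_assoc, show e * e = e from he.1.isIdempotentElem]
  · have h1 : centralCover e * (e * q) = centralCover e * e := by
      refine hsup.mul_eq_mul ?_
      rintro _ ⟨α, rfl⟩
      rw [← mul_assoc]
      exact hle _ ⟨α, rfl⟩
    rw [← mul_assoc, heC.mul_eq_right he.1 hC.1] at h1
    exact h1
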